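/- A qubit quantum operation is a map $\mathcal E(\rho)=\sum_{i=1}^m E_i\rho E_i^\dagger$ on $2\times 2$ complex matrices with $\sum_i E_i^\dagger E_i=I$. For states $\rho_0,\rho_1$ let $\tilde F(\rho_0,\rho_1)=\max\{|\langle\psi_0|\psi_1\rangle| : |\psi_k\rangle\in\mathrm{supp}(\rho_k),\ \|\psi_k\|=1,\ k=0,1\}$, where $\mathrm{supp}(\rho)$ is the span of the eigenvectors of $\rho$ with positive eigenvalue, and let $$\tilde F_1(\mathcal E,\mathcal I)=\min_{\|\psi\|=1}\tilde F\bigl(\mathcal E(|\psi\rangle\langle\psi|),|\psi\rangle\langle\psi|\bigr),$$ where $\mathcal I$ is the identity operation. A sequential scheme with $N$ queries to an unknown $X\in\{\mathcal E,\mathcal I\}$ prepares one qubit in a known state, applies $X$ to it $N$ times, with arbitrary known qubit quantum operations in between, and finally measures the qubit (no auxiliary systems); it distinguishes $\mathcal E$ from $\mathcal I$ perfectly if the measurement outcome identifies $X$ with certainty. $\mathcal E$ and $\mathcal I$ are sequentially perfectly distinguishable if such a scheme exists for some finite $N$. **Theorem.** Let $\mathcal E(\rho)=\sum_{i=1}^m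 E_i\rho E_i^\dagger$, with $2\le m\le 3$, be a qubit quantum operation. Then $\mathcal E$ and $\mathcal I$ are sequentially perfectly distinguishable if and only if $\tilde F_1(\mathcal E,\mathcal I)<1$. In that case the minimal number $N_{\min}$ of queries in a perfectly distinguishing sequential scheme is $$N_{\min}=\left\lceil\frac{\pi}{2\arccos\tilde F_1(\mathcal E,\mathcal I)}\right\rceil .$$ -/

import Mathlib

open scoped Matrix ComplexOrder

namespace QuantumDiscrimination

/-- Operators on the `d`-dimensional Hilbert space `EuclideanSpace ℂ (Fin d)`, as matrices. -/
abbrev Op (d : ℕ) := Matrix (Fin d) (Fin d) ℂ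

/-- Quantum states: positive semidefinite operators of trace one. -/
def IsState {d : ℕ} (ρ : Op d) : Prop :=
  ρ.PosSemidef ∧ ρ.trace = 1

/-- The density operator `|ψ⟩⟨ψ|` of a vector `ψ`. -/
def pureState {d : ℕ} (ψ : EuclideanSpace ℂ (Fin d)) : Op d :=
  Matrix.of fun i j => ψ i * star (ψ j)

/-- The Kraus condition `∑ i, Eᵢ† Eᵢ = I`. -/
def IsKraus {d d' m : ℕ} (E : Fin m → Matrix (Fin d') (Fin d) ℂ) : Prop :=
  ∑ i, (E i)ᴴ * E i = 1

/-- The map `ρ ↦ ∑ i, Eᵢ ρ Eᵢ†`. -/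
def krausMap {d d' m : ℕ} (E : Fin m → Matrix (Fin d') (Fin d) ℂ) : Op d →ₗ[ℂ] Op d' where
  toFun ρ := ∑ i, E i * ρ * (E i)ᴴ
  map_add' ρ σ := by
    simp only [Matrix.mul_add, Matrix.add_mul, Finset.sum_add_distrib]
  map_smul' c ρ := by
    simp only [Matrix.mul_smul, Matrix.smul_mul, Finset.smul_sum, RingHom.id_apply]

/-- Quantum operations (trace-preserving completely positive maps), in operator-sum form with
finitely many Kraus operators. -/
def IsQuantumOperation {d d' : ℕ} (T : Op d →ₗ[ℂ] Op d') : Prop :=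
  ∃ (m : ℕ) (K : Fin m → Matrix (Fin d') (Fin d) ℂ), IsKraus K ∧ T = krausMap K

/-- The support of a positive operator: the span of its eigenvectors with positive eigenvalue. -/
def supp {d : ℕ} (ρ : Op d) : Submodule ℂ (EuclideanSpace ℂ (Fin d)) :=
  Submodule.span ℂ {v | ∃ p : ℝ, 0 < p ∧ Matrix.toEuclideanLin ρ v = (p : ℂ) • v}

/-- The maximal fidelity of two states: the maximum of `|⟨ψ₀|ψ₁⟩|` over unit vectors `ψ₀`, `ψ₁`
in the respective supports. -/
noncomputable def maxFidelity {d : ℕ} (ρ₀ ρ₁ : Op d) : ℝ :=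
  sSup {x | ∃ ψ₀ ∈ supp ρ₀, ∃ ψ₁ ∈ supp ρ₁, ‖ψ₀‖ = 1 ∧ ‖ψ₁‖ = 1 ∧ x = ‖inner ℂ ψ₀ ψ₁‖}

/-- The `q`-maximal fidelity of two quantum operations: the minimum of the maximal fidelity of the
outputs over all pairs of pure input states with inner product `q`. -/
noncomputable def qMaxFidelity {d d' : ℕ} (q : ℝ) (E₀ E₁ : Op d →ₗ[ℂ] Op d') : ℝ :=
  sInf {x | ∃ ψ₀ ψ₁ : EuclideanSpace ℂ (Fin d), ‖ψ₀‖ = 1 ∧ ‖ψ₁‖ = 1 ∧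
    inner ℂ ψ₀ ψ₁ = (q : ℂ) ∧ x = maxFidelity (E₀ (pureState ψ₀)) (E₁ (pureState ψ₁))}

/-- Two states are perfectly distinguishable: some two-outcome measurement `{P, I - P}` gives the
first outcome with probability one on `ρ₀` and with probability zero on `ρ₁`. -/
def StatesPerfectlyDistinguishable {d : ℕ} (ρ₀ ρ₁ : Op d) : Prop :=
  ∃ P : Op d, P.PosSemidef ∧ (1 - P).PosSemidef ∧ (P * ρ₀).trace = 1 ∧ (P * ρ₁).trace = 0

/-- The state of the system, prepared in `ρ`, after `N` queries to `X`, where the `k`-th query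
(counted from zero) is followed by the operation `T k`. -/
def seqOutput {d : ℕ} (X : Op d →ₗ[ℂ] Op d) (T : ℕ → (Op d →ₗ[ℂ] Op d)) (ρ : Op d) : ℕ → Op d
  | 0 => ρ
  | N + 1 => T N (X (seqOutput X T ρ N))

/-- `X₀` and `X₁` can be perfectly distinguished by a sequential scheme with exactly `N` queries,
without auxiliary systems: an input state, a known quantum operation on the same system after each
query (the one after the last query being a part of the final measurement), and a final
measurement. -/
def SeqDistinguishableIn {d : ℕ} (X₀ X₁ : Op d →ₗ[ℂ] Op d) (N : ℕ) : Prop :=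
  ∃ (ρ : Op d) (T : ℕ → (Op d →ₗ[ℂ] Op d)), IsState ρ ∧ (∀ k, IsQuantumOperation (T k)) ∧
    StatesPerfectlyDistinguishable (seqOutput X₀ T ρ N) (seqOutput X₁ T ρ N)

/-- `X₀` and `X₁` are sequentially perfectly distinguishable, by finitely many queries. -/
def SeqDistinguishable {d : ℕ} (X₀ X₁ : Op d →ₗ[ℂ] Op d) : Prop :=
  ∃ N : ℕ, SeqDistinguishableIn X₀ X₁ N

end QuantumDiscrimination

open QuantumDiscrimination

namespace QuantumDiscrimination

/-! Everything is measured by the Fubini–Study angle between lines, with θ the arccosine of the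
minimal fidelity. A scheme runs two branches, one querying the operation and one querying the
identity. Perfect distinguishability forces the supports of the two final states to be orthogonal.

Lower bound: one can follow a pair of unit vectors, one in the support of each branch, whose angle
grows by at most θ per query. A singular qubit state is pure, so a query sends a pure state either
to a pure state at angle at most θ or to a state of full support, which still contains the input
(`exists_lineAngle_le_arccos_qMaxFidelity`). A known operation has a choice of Kraus outputs that
does not increase the angle (`exists_lineAngle_kraus_le`). The triangle inequality then gives π/2 ≤
Nθ.

Upper bound: if the minimal fidelity is below one, compactness provides a pure input ψ with pure
output φ at angle at least θ (`exists_pureState_norm_inner_le_qMaxFidelity`). A qubit operation can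
turn a pair of pure states into any pair no farther apart
(`exists_isQuantumOperation_map_pureState`). Before each query the pair is therefore moved to (ψ,
χ), with χ continuing the arc from φ through ψ; the query then adds the full angle, until
orthogonality is reached (`reachable_pureState`). -/

/-! ### Rank-one operators and Kraus maps. -/

/-- The operator `|x⟩⟨y|`. -/
def ketBra {d d' : ℕ} (x : EuclideanSpace ℂ (Fin d')) (y : EuclideanSpace ℂ (Fin d)) :
    Matrix (Fin d') (Fin d) ℂ :=
  Matrix.of fun i j => x i * star (y j)

theorem pureState_eq_ketBra {d : ℕ} (ψ : EuclideanSpace ℂ (Fin d)) :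
    pureState ψ = ketBra ψ ψ := rfl

theorem inner_eq_sum {d : ℕ} (x y : EuclideanSpace ℂ (Fin d)) :
    inner ℂ x y = ∑ i, star (x i) * y i := by
  simp [PiLp.inner_apply, mul_comm]

theorem toEuclideanLin_ketBra {d d' : ℕ} (x : EuclideanSpace ℂ (Fin d'))
    (y v : EuclideanSpace ℂ (Fin d)) :
    Matrix.toEuclideanLin (ketBra x y) v = inner ℂ y v • x := by
  ext i
  simp [Matrix.toLpLin_apply, Matrix.mulVec, dotProduct, ketBra, inner_eq_sum, Finset.sum_mul]
  exact Finset.sum_congr rfl fun j _ => by ring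

theorem conjTranspose_ketBra {d d' : ℕ} (x : EuclideanSpace ℂ (Fin d'))
    (y : EuclideanSpace ℂ (Fin d)) : (ketBra x y)ᴴ = ketBra y x := by
  ext i j
  simp [ketBra, mul_comm]

theorem ketBra_mul_ketBra {d d' d'' : ℕ} (x : EuclideanSpace ℂ (Fin d''))
    (y z : EuclideanSpace ℂ (Fin d')) (w : EuclideanSpace ℂ (Fin d)) :
    ketBra x y * ketBra z w = inner ℂ y z • ketBra x w := by
  ext i j
  simp [ketBra, inner_eq_sum, Matrix.mul_apply, Finset.sum_mul]
  exact Finset.sum_congr rfl fun j _ => by ring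

theorem ketBra_smul_left {d d' : ℕ} (c : ℂ) (x : EuclideanSpace ℂ (Fin d'))
    (y : EuclideanSpace ℂ (Fin d)) : ketBra (c • x) y = c • ketBra x y := by
  ext i j
  simp [ketBra, mul_assoc]

theorem ketBra_smul_right {d d' : ℕ} (c : ℂ) (x : EuclideanSpace ℂ (Fin d'))
    (y : EuclideanSpace ℂ (Fin d)) : ketBra x (c • y) = star c • ketBra x y := by
  ext i j
  simp [ketBra]
  ring

theorem trace_ketBra {d : ℕ} (x y : EuclideanSpace ℂ (Fin d)) :
    (ketBra x y).trace = inner ℂ y x := by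
  simp [ketBra, Matrix.trace, inner_eq_sum, mul_comm]

theorem trace_mul_ketBra {d : ℕ} (A : Op d) (x y : EuclideanSpace ℂ (Fin d)) :
    (A * ketBra x y).trace = inner ℂ y (Matrix.toEuclideanLin A x) := by
  simp [ketBra, Matrix.trace, Matrix.mul_apply, inner_eq_sum, Matrix.toLpLin_apply, Matrix.mulVec,
    dotProduct, Finset.mul_sum]
  exact Finset.sum_congr rfl fun i _ => Finset.sum_congr rfl fun j _ => by ring

theorem mul_ketBra_mul_conjTranspose {d d' : ℕ} (K : Matrix (Fin d') (Fin d) ℂ)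
    (x y : EuclideanSpace ℂ (Fin d)) :
    K * ketBra x y * Kᴴ = ketBra (Matrix.toEuclideanLin K x) (Matrix.toEuclideanLin K y) := by
  ext i j
  simp [ketBra, Matrix.toLpLin_apply, Matrix.mulVec, dotProduct, Matrix.mul_apply, Finset.sum_mul,
    Finset.mul_sum]
  refine Finset.sum_congr rfl fun i _ => Finset.sum_congr rfl fun j _ => by ring

theorem krausMap_pureState {d d' m : ℕ} (K : Fin m → Matrix (Fin d') (Fin d) ℂ)
    (ψ : EuclideanSpace ℂ (Fin d)) :
    krausMap K (pureState ψ) = ∑ i, pureState (Matrix.toEuclideanLin (K i) ψ) := by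
  simp [krausMap, pureState_eq_ketBra, mul_ketBra_mul_conjTranspose]

theorem pureState_smul {d : ℕ} (c : ℂ) (ψ : EuclideanSpace ℂ (Fin d)) :
    pureState (c • ψ) = ((‖c‖ ^ 2 : ℝ) : ℂ) • pureState ψ := by
  rw [pureState_eq_ketBra, ketBra_smul_left, ketBra_smul_right, smul_smul, ← pureState_eq_ketBra]
  congr 1
  push_cast
  exact Complex.mul_conj' c

theorem inner_toEuclideanLin_left {d d' : ℕ} (A : Matrix (Fin d') (Fin d) ℂ)
    (x : EuclideanSpace ℂ (Fin d)) (y : EuclideanSpace ℂ (Fin d')) :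
    inner ℂ (Matrix.toEuclideanLin A x) y = inner ℂ x (Matrix.toEuclideanLin Aᴴ y) := by
  rw [Matrix.toEuclideanLin_conjTranspose_eq_adjoint, LinearMap.adjoint_inner_right]

theorem isState_pureState {d : ℕ} {ψ : EuclideanSpace ℂ (Fin d)} (h : ‖ψ‖ = 1) :
    IsState (pureState ψ) := by
  refine ⟨Matrix.posSemidef_vecMulVec_self_star ψ.ofLp, ?_⟩
  rw [pureState_eq_ketBra, trace_ketBra, inner_self_eq_norm_sq_to_K, h]
  simp

theorem posSemidef_krausMap {d d' m : ℕ} (K : Fin m → Matrix (Fin d') (Fin d) ℂ) {ρ : Op d}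
    (h : ρ.PosSemidef) : (krausMap K ρ).PosSemidef :=
  Matrix.posSemidef_sum _ fun i _ => h.mul_mul_conjTranspose_same (K i)

theorem trace_krausMap {d d' m : ℕ} {K : Fin m → Matrix (Fin d') (Fin d) ℂ} (hK : IsKraus K)
    (ρ : Op d) : (krausMap K ρ).trace = ρ.trace := by
  have h : ∀ i, (K i * ρ * (K i)ᴴ).trace = ((K i)ᴴ * K i * ρ).trace := fun i => by
    rw [Matrix.trace_mul_comm, Matrix.mul_assoc]
  have : (krausMap K ρ).trace = ∑ i, (K i * ρ * (K i)ᴴ).trace :=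
    Matrix.trace_sum Finset.univ fun i => K i * ρ * (K i)ᴴ
  rw [this, Finset.sum_congr rfl fun i _ => h i, ← Matrix.trace_sum, ← Finset.sum_mul, hK, one_mul]

theorem isState_krausMap {d d' m : ℕ} {K : Fin m → Matrix (Fin d') (Fin d) ℂ} (hK : IsKraus K)
    {ρ : Op d} (h : IsState ρ) : IsState (krausMap K ρ) :=
  ⟨posSemidef_krausMap K h.1, (trace_krausMap hK ρ).trans h.2⟩

theorem sum_inner_kraus {d d' m : ℕ} {K : Fin m → Matrix (Fin d') (Fin d) ℂ} (hK : IsKraus K)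
    (x y : EuclideanSpace ℂ (Fin d)) :
    ∑ i, inner ℂ (Matrix.toEuclideanLin (K i) x) (Matrix.toEuclideanLin (K i) y) = inner ℂ x y := by
  have h : ∀ i, inner ℂ (Matrix.toEuclideanLin (K i) x) (Matrix.toEuclideanLin (K i) y) =
      (((K i)ᴴ * K i) * ketBra y x).trace := fun i => by
    rw [trace_mul_ketBra, inner_toEuclideanLin_left]
    simp [Matrix.toLpLin_apply]
  rw [Finset.sum_congr rfl fun i _ => h i, ← Matrix.trace_sum, ← Finset.sum_mul, hK, one_mul,
    trace_ketBra]

/-! ### Supports of positive operators. -/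

/-- Turns inclusions of supports into reversed inclusions of kernels; the spectral basis gives the
nontrivial inclusion. -/
theorem supp_eq_orthogonal_ker {d : ℕ} {ρ : Op d} (h : ρ.PosSemidef) :
    supp ρ = (LinearMap.ker (Matrix.toEuclideanLin ρ))ᗮ := by
  apply le_antisymm
  · refine Submodule.span_le.2 ?_
    rintro v ⟨p, hp, hv⟩ w hw
    have h0 : inner ℂ w (Matrix.toEuclideanLin ρ v) = 0 := by
      have := inner_toEuclideanLin_left ρ w v
      rw [h.1.eq] at this
      rw [← this, LinearMap.mem_ker.1 hw, inner_zero_left]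
    rw [hv, inner_smul_right] at h0
    exact (mul_eq_zero.1 h0).resolve_left (by exact_mod_cast hp.ne')
  · rw [← Submodule.orthogonal_orthogonal (supp ρ)]
    refine Submodule.orthogonal_le fun v hv => ?_
    have hb : ∀ i, Matrix.toEuclideanLin ρ (h.1.eigenvectorBasis i) =
        ((h.1.eigenvalues i : ℝ) : ℂ) • h.1.eigenvectorBasis i := fun i => by
      rw [Matrix.toLpLin_apply, h.1.mulVec_eigenvectorBasis i]
      ext j
      simp
    rw [LinearMap.mem_ker, ← h.1.eigenvectorBasis.sum_repr' v, map_sum]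
    refine Finset.sum_eq_zero fun i _ => ?_
    rw [map_smul, hb]
    rcases (h.eigenvalues_nonneg i).eq_or_lt with h0 | h0
    · simp [← h0]
    · rw [(Submodule.mem_orthogonal _ _).1 hv _ (Submodule.subset_span ⟨_, h0, hb i⟩), zero_smul]

/-- The quadratic form of the output at v is a sum of nonnegative terms, so each term vanishes with
it. -/
theorem mem_ker_krausMap {d d' m : ℕ} (K : Fin m → Matrix (Fin d') (Fin d) ℂ) {ρ : Op d}
    (h : ρ.PosSemidef) {v : EuclideanSpace ℂ (Fin d')}
    (hv : Matrix.toEuclideanLin (krausMap K ρ) v = 0) (i : Fin m) :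
    Matrix.toEuclideanLin ρ (Matrix.toEuclideanLin (K i)ᴴ v) = 0 := by
  have hq : ∀ i, star v.ofLp ⬝ᵥ (K i * ρ * (K i)ᴴ) *ᵥ v.ofLp =
      star ((K i)ᴴ *ᵥ v.ofLp) ⬝ᵥ ρ *ᵥ ((K i)ᴴ *ᵥ v.ofLp) := fun i => by
    rw [Matrix.star_mulVec, Matrix.conjTranspose_conjTranspose, ← Matrix.dotProduct_mulVec,
      Matrix.mulVec_mulVec, Matrix.mulVec_mulVec, Matrix.mul_assoc]
  have h0 : ∑ i, star v.ofLp ⬝ᵥ (K i * ρ * (K i)ᴴ) *ᵥ v.ofLp = 0 := by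
    rw [← dotProduct_sum, ← Matrix.sum_mulVec]
    have : krausMap K ρ *ᵥ v.ofLp = 0 := by
      simpa [Matrix.toLpLin_apply] using hv
    have h2 : (∑ i, K i * ρ * (K i)ᴴ) *ᵥ v.ofLp = 0 := this
    rw [h2, dotProduct_zero]
  simp only [hq] at h0
  have h1 := (Finset.sum_eq_zero_iff_of_nonneg fun i _ => h.dotProduct_mulVec_nonneg _).1 h0 i
    (Finset.mem_univ i)
  rw [h.dotProduct_mulVec_zero_iff] at h1
  simp [Matrix.toLpLin_apply, h1]

theorem toEuclideanLin_kraus_mem_supp {d d' m : ℕ} (K : Fin m → Matrix (Fin d') (Fin d) ℂ)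
    {ρ : Op d} (h : ρ.PosSemidef) {ψ : EuclideanSpace ℂ (Fin d)} (hψ : ψ ∈ supp ρ) (i : Fin m) :
    Matrix.toEuclideanLin (K i) ψ ∈ supp (krausMap K ρ) := by
  rw [supp_eq_orthogonal_ker (posSemidef_krausMap K h)]
  rw [supp_eq_orthogonal_ker h] at hψ
  intro v hv
  rw [← inner_conj_symm, inner_toEuclideanLin_left, ← inner_conj_symm ψ,
    hψ _ (mem_ker_krausMap K h hv i)]
  simp

/-- Allows a mixed input to be replaced by any single unit vector of its support. -/
theorem supp_krausMap_pureState_le {d d' m : ℕ} (K : Fin m → Matrix (Fin d') (Fin d) ℂ)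
    {ρ : Op d} (h : ρ.PosSemidef) {ψ : EuclideanSpace ℂ (Fin d)} (hψ : ψ ∈ supp ρ)
    (hn : ‖ψ‖ = 1) :
    supp (krausMap K (pureState ψ)) ≤ supp (krausMap K ρ) := by
  rw [supp_eq_orthogonal_ker (posSemidef_krausMap K h),
    supp_eq_orthogonal_ker (posSemidef_krausMap K (isState_pureState hn).1)]
  refine Submodule.orthogonal_le fun v hv => ?_
  rw [LinearMap.mem_ker, krausMap_pureState, map_sum, LinearMap.sum_apply]
  refine Finset.sum_eq_zero fun i _ => ?_
  have := toEuclideanLin_kraus_mem_supp K h hψ i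
  rw [supp_eq_orthogonal_ker (posSemidef_krausMap K h)] at this
  rw [pureState_eq_ketBra, toEuclideanLin_ketBra, ← inner_conj_symm, this v hv]
  simp

theorem mem_supp_pureState {d : ℕ} {φ : EuclideanSpace ℂ (Fin d)} (hn : ‖φ‖ = 1)
    {v : EuclideanSpace ℂ (Fin d)} : v ∈ supp (pureState φ) ↔ ∃ c : ℂ, v = c • φ := by
  constructor
  · intro hv
    refine (Submodule.span_le.2 ?_ : supp (pureState φ) ≤ Submodule.span ℂ {φ}) hv |>
      Submodule.mem_span_singleton.1 |>.imp fun _ h => h.symm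
    rintro w ⟨p, hp, hw⟩
    rw [pureState_eq_ketBra, toEuclideanLin_ketBra] at hw
    have hp' : (p : ℂ) ≠ 0 := by exact_mod_cast hp.ne'
    refine Submodule.mem_span_singleton.2 ⟨(p : ℂ)⁻¹ * inner ℂ φ w, ?_⟩
    rw [mul_smul, hw, smul_smul, inv_mul_cancel₀ hp', one_smul]
  · rintro ⟨c, rfl⟩
    refine Submodule.smul_mem _ _ (Submodule.subset_span ⟨1, one_pos, ?_⟩)
    rw [pureState_eq_ketBra, toEuclideanLin_ketBra, inner_self_eq_norm_sq_to_K, hn]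
    simp

/-! ### The angle between lines and its behaviour under Kraus operators. -/

/-- The Fubini–Study angle between the lines spanned by two unit vectors. -/
noncomputable def lineAngle {d : ℕ} (x y : EuclideanSpace ℂ (Fin d)) : ℝ :=
  Real.arccos ‖(inner ℂ x y : ℂ)‖

theorem exists_phase (z : ℂ) : ∃ c : ℂ, ‖c‖ = 1 ∧ c * z = (‖z‖ : ℂ) := by
  rcases eq_or_ne z 0 with rfl | hz
  · exact ⟨1, by simp⟩
  · have hz' : (‖z‖ : ℂ) ≠ 0 := by exact_mod_cast norm_ne_zero_iff.2 hz
    refine ⟨star z / ‖z‖, by simp [hz], ?_⟩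
    have := Complex.conj_mul' z
    rw [Complex.star_def, div_mul_eq_mul_div, this]
    field_simp

/-- Phases make the inner products of x and z with y real and nonnegative, so the real angles at y
become line angles. The real angle between the rotated x and z can only exceed their line angle,
since Re w ≤ |w|. -/
theorem lineAngle_triangle {d : ℕ} {x y z : EuclideanSpace ℂ (Fin d)} (hx : ‖x‖ = 1)
    (hy : ‖y‖ = 1) (hz : ‖z‖ = 1) : lineAngle x z ≤ lineAngle x y + lineAngle y z := by
  let _ : InnerProductSpace ℝ (EuclideanSpace ℂ (Fin d)) := InnerProductSpace.rclikeToReal ℂ _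
  have key : ∀ {u v : EuclideanSpace ℂ (Fin d)}, ‖u‖ = 1 → ‖v‖ = 1 →
      InnerProductGeometry.angle u v = Real.arccos (inner ℂ u v : ℂ).re := fun hu hv => by
    rw [InnerProductGeometry.angle, hu, hv]
    simp [real_inner_eq_re_inner ℂ]
  obtain ⟨c, hc, hc'⟩ := exists_phase (inner ℂ y x)
  obtain ⟨e, he, he'⟩ := exists_phase (inner ℂ y z)
  have hx' : ‖c • x‖ = 1 := by rw [norm_smul, hc, hx, one_mul]
  have hz' : ‖e • z‖ = 1 := by rw [norm_smul, he, hz, one_mul]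
  have h := InnerProductGeometry.angle_le_angle_add_angle (c • x) y (e • z)
  rw [InnerProductGeometry.angle_comm (c • x) y, key hx' hz', key hy hx', key hy hz',
    inner_smul_right y, inner_smul_right y, hc', he', Complex.ofReal_re, Complex.ofReal_re,
    norm_inner_symm] at h
  refine le_trans (Real.arccos_le_arccos ?_) h
  refine (Complex.re_le_norm _).trans ?_
  rw [inner_smul_left, inner_smul_right, norm_mul, norm_mul, RCLike.norm_conj, hc, he]
  simp

theorem norm_inv_norm_smul {d : ℕ} {x : EuclideanSpace ℂ (Fin d)} (hx : x ≠ 0) :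
    ‖((‖x‖ : ℂ)⁻¹) • x‖ = 1 := by
  rw [norm_smul, norm_inv, Complex.norm_real, norm_norm, inv_mul_cancel₀ (norm_ne_zero_iff.2 hx)]

theorem sum_norm_sq_kraus {d d' m : ℕ} {K : Fin m → Matrix (Fin d') (Fin d) ℂ}
    (hK : IsKraus K) (x : EuclideanSpace ℂ (Fin d)) :
    ∑ i, ‖Matrix.toEuclideanLin (K i) x‖ ^ 2 = ‖x‖ ^ 2 := by
  have h := sum_inner_kraus hK x x
  simp only [inner_self_eq_norm_sq_to_K] at h
  exact_mod_cast h

theorem exists_kraus_ne_zero {d d' m : ℕ} {K : Fin m → Matrix (Fin d') (Fin d) ℂ}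
    (hK : IsKraus K) {x : EuclideanSpace ℂ (Fin d)} (hx : ‖x‖ = 1) :
    ∃ i, Matrix.toEuclideanLin (K i) x ≠ 0 := by
  by_contra! h
  have := sum_norm_sq_kraus hK x
  simp [h, hx] at this

/-- The overlaps of the Kraus outputs sum to ⟨x, y⟩, while the products of their norms sum to at
most 1. Hence not every normalized overlap can be smaller than |⟨x, y⟩|. -/
theorem exists_norm_inner_kraus_ge {d d' m : ℕ} {K : Fin m → Matrix (Fin d') (Fin d) ℂ}
    (hK : IsKraus K) {x y : EuclideanSpace ℂ (Fin d)} (hx : ‖x‖ = 1) (hy : ‖y‖ = 1)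
    (hxy : (inner ℂ x y : ℂ) ≠ 0) :
    ∃ i, Matrix.toEuclideanLin (K i) x ≠ 0 ∧ Matrix.toEuclideanLin (K i) y ≠ 0 ∧
      ‖(inner ℂ x y : ℂ)‖ * (‖Matrix.toEuclideanLin (K i) x‖ * ‖Matrix.toEuclideanLin (K i) y‖) ≤
        ‖(inner ℂ (Matrix.toEuclideanLin (K i) x) (Matrix.toEuclideanLin (K i) y) : ℂ)‖ := by
  by_contra! h
  set c := ‖(inner ℂ x y : ℂ)‖
  have hc : 0 < c := norm_pos_iff.2 hxy
  set X := fun i => Matrix.toEuclideanLin (K i) x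
  set Y := fun i => Matrix.toEuclideanLin (K i) y
  have h1 : ∀ i, ‖(inner ℂ (X i) (Y i) : ℂ)‖ ≤ c * (‖X i‖ * ‖Y i‖) := fun i => by
    by_cases hX : X i = 0
    · simp [hX]
    by_cases hY : Y i = 0
    · simp [hY]
    exact (h i hX hY).le
  have h2 : ∑ i, ‖X i‖ * ‖Y i‖ ≤ 1 := by
    have hs : ∑ i, (‖X i‖ ^ 2 + ‖Y i‖ ^ 2) / 2 = 1 := by
      rw [← Finset.sum_div, Finset.sum_add_distrib, sum_norm_sq_kraus hK, sum_norm_sq_kraus hK,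
        hx, hy]
      norm_num
    rw [← hs]
    exact Finset.sum_le_sum fun i _ => by nlinarith [sq_nonneg (‖X i‖ - ‖Y i‖)]
  have h3 : c ≤ ∑ i, ‖(inner ℂ (X i) (Y i) : ℂ)‖ := by
    have := norm_sum_le Finset.univ fun i => (inner ℂ (X i) (Y i) : ℂ)
    rwa [sum_inner_kraus hK x y] at this
  by_cases hne : ∃ i, X i ≠ 0 ∧ Y i ≠ 0
  · obtain ⟨i, hX, hY⟩ := hne
    have := Finset.sum_lt_sum (fun i _ => h1 i) ⟨i, Finset.mem_univ i, h i hX hY⟩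
    rw [← Finset.mul_sum] at this
    nlinarith
  · push Not at hne
    have : ∑ i, ‖(inner ℂ (X i) (Y i) : ℂ)‖ = 0 := Finset.sum_eq_zero fun i _ => by
      by_cases hX : X i = 0
      · simp [hX]
      · simp [hne i hX]
    linarith

theorem lineAngle_nonneg {d : ℕ} (x y : EuclideanSpace ℂ (Fin d)) : 0 ≤ lineAngle x y :=
  Real.arccos_nonneg _

theorem lineAngle_le_pi_div_two {d : ℕ} (x y : EuclideanSpace ℂ (Fin d)) :
    lineAngle x y ≤ Real.pi / 2 :=
  Real.arccos_le_pi_div_two.2 (norm_nonneg _)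

theorem norm_inner_smul_inv_norm {d : ℕ} (x y : EuclideanSpace ℂ (Fin d)) :
    ‖(inner ℂ ((‖x‖ : ℂ)⁻¹ • x) ((‖y‖ : ℂ)⁻¹ • y) : ℂ)‖ = ‖(inner ℂ x y : ℂ)‖ / (‖x‖ * ‖y‖) := by
  rw [inner_smul_left, inner_smul_right]
  simp
  ring

theorem exists_lineAngle_kraus_le {d d' m : ℕ} {K : Fin m → Matrix (Fin d') (Fin d) ℂ}
    (hK : IsKraus K) {x y : EuclideanSpace ℂ (Fin d)} (hx : ‖x‖ = 1) (hy : ‖y‖ = 1) :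
    ∃ (i j : Fin m) (a b : ℂ), ‖a • Matrix.toEuclideanLin (K i) x‖ = 1 ∧
      ‖b • Matrix.toEuclideanLin (K j) y‖ = 1 ∧
      lineAngle (a • Matrix.toEuclideanLin (K i) x) (b • Matrix.toEuclideanLin (K j) y) ≤
        lineAngle x y := by
  -- For orthogonal inputs the angle is already maximal, so any nonzero outputs do, possibly from
  -- different Kraus operators.
  by_cases hxy : (inner ℂ x y : ℂ) = 0
  · obtain ⟨i, hi⟩ := exists_kraus_ne_zero hK hx
    obtain ⟨j, hj⟩ := exists_kraus_ne_zero hK hy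
    refine ⟨i, j, _, _, norm_inv_norm_smul hi, norm_inv_norm_smul hj, ?_⟩
    refine (lineAngle_le_pi_div_two _ _).trans (le_of_eq ?_)
    simp [lineAngle, hxy]
  · obtain ⟨i, hX, hY, h⟩ := exists_norm_inner_kraus_ge hK hx hy hxy
    refine ⟨i, i, _, _, norm_inv_norm_smul hX, norm_inv_norm_smul hY, ?_⟩
    refine Real.arccos_le_arccos ?_
    rw [norm_inner_smul_inv_norm]
    exact (le_div_iff₀ (mul_pos (norm_pos_iff.2 hX) (norm_pos_iff.2 hY))).2 h

theorem exists_unit_mem_supp_of_isQuantumOperation {d d' : ℕ} {T : Op d →ₗ[ℂ] Op d'}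
    (hT : IsQuantumOperation T) {ρ σ : Op d} (hρ : ρ.PosSemidef) (hσ : σ.PosSemidef)
    {x y : EuclideanSpace ℂ (Fin d)} (hx : ‖x‖ = 1) (hy : ‖y‖ = 1) (hxs : x ∈ supp ρ)
    (hys : y ∈ supp σ) : ∃ x' ∈ supp (T ρ), ∃ y' ∈ supp (T σ), ‖x'‖ = 1 ∧ ‖y'‖ = 1 ∧
      lineAngle x' y' ≤ lineAngle x y := by
  obtain ⟨m, K, hK, rfl⟩ := hT
  obtain ⟨i, j, a, b, h1, h2, h3⟩ := exists_lineAngle_kraus_le hK hx hy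
  exact ⟨_, Submodule.smul_mem _ _ (toEuclideanLin_kraus_mem_supp K hρ hxs i), _,
    Submodule.smul_mem _ _ (toEuclideanLin_kraus_mem_supp K hσ hys j), h1, h2, h3⟩

theorem isState_apply {d d' : ℕ} {T : Op d →ₗ[ℂ] Op d'} (hT : IsQuantumOperation T) {ρ : Op d}
    (hρ : IsState ρ) : IsState (T ρ) := by
  obtain ⟨m, K, hK, rfl⟩ := hT
  exact isState_krausMap hK hρ

theorem isQuantumOperation_id {d : ℕ} : IsQuantumOperation (LinearMap.id : Op d →ₗ[ℂ] Op d) := by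
  refine ⟨1, fun _ => 1, by simp [IsKraus], ?_⟩
  ext1 ρ
  simp [krausMap]

theorem isState_seqOutput {d : ℕ} {X : Op d →ₗ[ℂ] Op d} {T : ℕ → (Op d →ₗ[ℂ] Op d)}
    (hX : IsQuantumOperation X) (hT : ∀ k, IsQuantumOperation (T k)) {ρ : Op d} (hρ : IsState ρ)
    (N : ℕ) : IsState (seqOutput X T ρ N) := by
  induction N with
  | zero => exact hρ
  | succ n ih => exact isState_apply (hT n) (isState_apply hX ih)

/-! ### Perfect distinguishability forces orthogonal supports. -/

/-- Two positive operators whose product has trace zero annihilate each other. -/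
theorem mul_eq_zero_of_trace_mul_eq_zero {d : ℕ} {P ρ : Op d} (hP : P.PosSemidef)
    (hρ : ρ.PosSemidef) (h : (P * ρ).trace = 0) : P * ρ = 0 := by
  open scoped MatrixOrder in
  obtain ⟨A, rfl⟩ := CStarAlgebra.nonneg_iff_eq_star_mul_self.mp hP.nonneg
  obtain ⟨B, rfl⟩ := CStarAlgebra.nonneg_iff_eq_star_mul_self.mp hρ.nonneg
  simp only [Matrix.star_eq_conjTranspose] at *
  have h0 : ((A * Bᴴ)ᴴ * (A * Bᴴ)).trace = 0 := by
    rw [Matrix.conjTranspose_mul, Matrix.conjTranspose_conjTranspose, Matrix.mul_assoc,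
      Matrix.trace_mul_comm, ← h]
    simp only [Matrix.mul_assoc]
  rw [Matrix.trace_conjTranspose_mul_self_eq_zero_iff] at h0
  rw [Matrix.mul_assoc, ← Matrix.mul_assoc A, h0]
  simp

theorem toEuclideanLin_eq_zero_of_mem_supp {d : ℕ} {P ρ : Op d} (h : P * ρ = 0)
    {v : EuclideanSpace ℂ (Fin d)} (hv : v ∈ supp ρ) : Matrix.toEuclideanLin P v = 0 := by
  refine (Submodule.span_le.2 ?_ : supp ρ ≤ LinearMap.ker (Matrix.toEuclideanLin P)) hv
  rintro w ⟨p, hp, hw⟩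
  have h0 : (p : ℂ) • Matrix.toEuclideanLin P w = 0 := by
    rw [← map_smul, ← hw]
    simp [Matrix.toLpLin_apply, h]
  exact (smul_eq_zero.1 h0).resolve_left (by exact_mod_cast hp.ne')

/-- The measurement operator acts as the identity on the first support and as zero on the second. -/
theorem inner_eq_zero_of_statesPerfectlyDistinguishable {d : ℕ} {ρ σ : Op d}
    (h : StatesPerfectlyDistinguishable ρ σ) (hρ : IsState ρ) (hσ : IsState σ)
    {x y : EuclideanSpace ℂ (Fin d)} (hx : x ∈ supp ρ) (hy : y ∈ supp σ) :
    (inner ℂ x y : ℂ) = 0 := by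
  obtain ⟨P, hP, hP', h1, h0⟩ := h
  have hPy := toEuclideanLin_eq_zero_of_mem_supp (mul_eq_zero_of_trace_mul_eq_zero hP hσ.1 h0) hy
  have hPx := toEuclideanLin_eq_zero_of_mem_supp
    (mul_eq_zero_of_trace_mul_eq_zero hP' hρ.1 (by rw [sub_mul, one_mul, Matrix.trace_sub, hρ.2,
      h1, sub_self])) hx
  have hPx' : Matrix.toEuclideanLin P x = x := by
    simp [map_sub, Matrix.toLpLin_apply] at hPx
    rw [sub_eq_zero] at hPx
    simpa [Matrix.toLpLin_apply] using hPx.symm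
  rw [← hPx', inner_toEuclideanLin_left, hP.1.eq, hPy, inner_zero_right]

theorem exists_unit_mem_supp {d : ℕ} {ρ : Op d} (h : IsState ρ) : ∃ x ∈ supp ρ, ‖x‖ = 1 := by
  have hne : supp ρ ≠ ⊥ := by
    intro h0
    have hk : LinearMap.ker (Matrix.toEuclideanLin ρ) = ⊤ := by
      rw [← Submodule.orthogonal_orthogonal (LinearMap.ker _), ← supp_eq_orthogonal_ker h.1, h0,
        Submodule.bot_orthogonal_eq_top]
    have : ρ = 0 := by
      rw [LinearMap.ker_eq_top] at hk
      exact (LinearEquiv.map_eq_zero_iff _).1 hk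
    have h1 := h.2
    simp [this] at h1
  obtain ⟨x, hx, hx0⟩ := Submodule.exists_mem_ne_zero_of_ne_bot hne
  exact ⟨_, Submodule.smul_mem _ _ hx, norm_inv_norm_smul hx0⟩

/-! ### Lower bound on the number of queries. -/

/-- If a query moves no pure state by an angle larger than `θ`, then `N` queries yield outputs
whose supports are at an angle of at most `N * θ`. -/
theorem exists_lineAngle_seqOutput_le {d : ℕ} {X : Op d →ₗ[ℂ] Op d} {θ : ℝ}
    (hX : IsQuantumOperation X)
    (hθ : ∀ ψ : EuclideanSpace ℂ (Fin d), ‖ψ‖ = 1 →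
      ∃ φ ∈ supp (X (pureState ψ)), ‖φ‖ = 1 ∧ lineAngle φ ψ ≤ θ)
    {T : ℕ → (Op d →ₗ[ℂ] Op d)} (hT : ∀ k, IsQuantumOperation (T k)) {ρ : Op d} (hρ : IsState ρ)
    (N : ℕ) :
    ∃ x ∈ supp (seqOutput X T ρ N), ∃ y ∈ supp (seqOutput LinearMap.id T ρ N),
      ‖x‖ = 1 ∧ ‖y‖ = 1 ∧ lineAngle x y ≤ N * θ := by
  induction N with
  | zero =>
    obtain ⟨x, hx, hn⟩ := exists_unit_mem_supp hρ
    refine ⟨x, hx, x, hx, hn, hn, ?_⟩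
    simp [lineAngle, hn]
  | succ n ih =>
    obtain ⟨x, hx, y, hy, hxn, hyn, hxy⟩ := ih
    obtain ⟨φ, hφ, hφn, hφx⟩ := hθ x hxn
    have hs := isState_seqOutput hX hT hρ n
    have hs' := isState_seqOutput isQuantumOperation_id hT hρ n
    have hφ' : φ ∈ supp (X (seqOutput X T ρ n)) := by
      obtain ⟨m, K, hK, rfl⟩ := hX
      exact supp_krausMap_pureState_le K hs.1 hx hxn hφ
    obtain ⟨x', hx', y', hy', hxn', hyn', h⟩ := exists_unit_mem_supp_of_isQuantumOperation (hT n)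
      (isState_apply hX hs).1 hs'.1 hφn hyn hφ' hy
    refine ⟨x', hx', y', hy', hxn', hyn', h.trans ?_⟩
    have := lineAngle_triangle hφn hxn hyn
    push_cast
    linarith

theorem pi_div_two_le_of_seqDistinguishableIn {d : ℕ} {X : Op d →ₗ[ℂ] Op d} {θ : ℝ}
    (hX : IsQuantumOperation X)
    (hθ : ∀ ψ : EuclideanSpace ℂ (Fin d), ‖ψ‖ = 1 →
      ∃ φ ∈ supp (X (pureState ψ)), ‖φ‖ = 1 ∧ lineAngle φ ψ ≤ θ)
    {N : ℕ} (h : SeqDistinguishableIn X LinearMap.id N) : Real.pi / 2 ≤ N * θ := by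
  obtain ⟨ρ, T, hρ, hT, h⟩ := h
  obtain ⟨x, hx, y, hy, -, -, hxy⟩ := exists_lineAngle_seqOutput_le hX hθ hT hρ N
  have := inner_eq_zero_of_statesPerfectlyDistinguishable h (isState_seqOutput hX hT hρ N)
    (isState_seqOutput isQuantumOperation_id hT hρ N) hx hy
  simpa [lineAngle, this] using hxy

/-! ### Transforming pairs of pure qubit states. -/

/-- Every qubit unit vector is part of an orthonormal basis. -/
theorem exists_orthonormal_complement {a : EuclideanSpace ℂ (Fin 2)} (ha : ‖a‖ = 1) :
    ∃ a' : EuclideanSpace ℂ (Fin 2), ‖a'‖ = 1 ∧ (inner ℂ a a' : ℂ) = 0 ∧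
      ketBra a a + ketBra a' a' = 1 := by
  have h : star (a 0) * a 0 + star (a 1) * a 1 = 1 := by
    have := inner_self_eq_norm_sq_to_K (𝕜 := ℂ) a
    rw [inner_eq_sum, Fin.sum_univ_two, ha] at this
    simpa using this
  refine ⟨!₂[-star (a 1), star (a 0)], ?_, ?_, ?_⟩
  · have := inner_self_eq_norm_sq_to_K (𝕜 := ℂ) (!₂[-star (a 1), star (a 0)])
    rw [inner_eq_sum, Fin.sum_univ_two] at this
    simp only [Matrix.cons_val_zero, Matrix.cons_val_one, star_neg, star_star,
      neg_mul_neg] at this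
    have h2 : ((‖!₂[-star (a 1), star (a 0)]‖ : ℂ)) ^ 2 = 1 := by
      rw [← h]
      refine this.symm.trans ?_
      ring
    have h3 : ‖!₂[-star (a 1), star (a 0)]‖ ^ 2 = 1 := by exact_mod_cast h2
    exact (pow_eq_one_iff_of_nonneg (norm_nonneg _) two_ne_zero).1 h3
  · rw [inner_eq_sum, Fin.sum_univ_two]
    simp
    ring
  · simp only [Complex.star_def] at h
    ext i j
    fin_cases i <;> fin_cases j <;> simp [ketBra]
    · linear_combination h
    · ring
    · ring
    · linear_combination h

theorem eq_add_of_ketBra_add_eq_one {d : ℕ} {a a' : EuclideanSpace ℂ (Fin d)}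
    (h : ketBra a a + ketBra a' a' = 1) (v : EuclideanSpace ℂ (Fin d)) :
    v = (inner ℂ a v : ℂ) • a + (inner ℂ a' v : ℂ) • a' := by
  rw [← toEuclideanLin_ketBra, ← toEuclideanLin_ketBra, ← LinearMap.add_apply, ← map_add, h]
  simp

theorem norm_sq_inner_add_norm_sq_inner {d : ℕ} {a a' : EuclideanSpace ℂ (Fin d)}
    (h : ketBra a a + ketBra a' a' = 1) (v : EuclideanSpace ℂ (Fin d)) :
    ‖(inner ℂ a v : ℂ)‖ ^ 2 + ‖(inner ℂ a' v : ℂ)‖ ^ 2 = ‖v‖ ^ 2 := by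
  have h1 := inner_self_eq_norm_sq_to_K (𝕜 := ℂ) v
  nth_rw 2 [eq_add_of_ketBra_add_eq_one h v] at h1
  rw [inner_add_right, inner_smul_right, inner_smul_right, ← inner_conj_symm v a,
    ← inner_conj_symm v a', RCLike.mul_conj, RCLike.mul_conj] at h1
  exact_mod_cast h1

/-- The first operator maps a to b and damps a' to y b'; the second dumps the lost weight of a' onto
b₁. -/
theorem isKraus_pair {a a' b b' b₁ : EuclideanSpace ℂ (Fin 2)} (ha : ketBra a a + ketBra a' a' = 1)
    (hb : ‖b‖ = 1) (hb' : ‖b'‖ = 1) (hbb : (inner ℂ b b' : ℂ) = 0) (hb₁ : ‖b₁‖ = 1)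
    {y : ℂ} {r : ℝ} (hyr : ‖y‖ ^ 2 + r ^ 2 = 1) :
    IsKraus ![ketBra b a + y • ketBra b' a', (r : ℂ) • ketBra b₁ a'] := by
  have hbb' : (inner ℂ b' b : ℂ) = 0 := by rw [← inner_conj_symm, hbb, map_zero]
  have hyr' : (star y * y + (r : ℂ) * r) = 1 := by
    rw [Complex.star_def, Complex.conj_mul']
    exact_mod_cast (by rw [← sq]; exact hyr)
  rw [IsKraus, Fin.sum_univ_two]
  simp only [Matrix.cons_val_zero, Matrix.cons_val_one, Matrix.conjTranspose_add,
    Matrix.conjTranspose_smul, conjTranspose_ketBra, Matrix.add_mul, Matrix.mul_add,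
    Matrix.smul_mul, Matrix.mul_smul, ketBra_mul_ketBra, inner_self_eq_norm_sq_to_K, hb, hb', hb₁,
    hbb, hbb', smul_smul, Complex.coe_algebraMap, Complex.ofReal_one, one_pow, one_smul,
    zero_smul, zero_add]
  rw [← ha, add_assoc, ← add_smul]
  have : y * star y + (r : ℂ) * star (r : ℂ) = 1 := by
    rw [← hyr', mul_comm y]
    simp
  rw [this, one_smul, smul_zero, add_zero]

/-- Damping the second coordinate of (u, v) makes it proportional to (s, t); this is possible
because |u| ≤ |s| forces |t| ≤ |v|. -/
theorem exists_norm_le_one_mul_eq {u v s t : ℂ} (huv : ‖u‖ ^ 2 + ‖v‖ ^ 2 = 1)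
    (hst : ‖s‖ ^ 2 + ‖t‖ ^ 2 = 1) (h : ‖u‖ ≤ ‖s‖) :
    ∃ y l : ℂ, ‖y‖ ≤ 1 ∧ u = l * s ∧ y * v = l * t := by
  have htv : ‖t‖ ≤ ‖v‖ := by
    have := pow_le_pow_left₀ (norm_nonneg _) h 2
    exact (sq_le_sq₀ (norm_nonneg _) (norm_nonneg _)).1 (by linarith)
  by_cases hs : s = 0
  · have hu : u = 0 := by simpa [hs] using h
    have ht : t ≠ 0 := by
      rintro rfl
      simp [hs] at hst
    exact ⟨1, v / t, by simp, by simp [hu, hs], by field_simp⟩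
  by_cases hv : v = 0
  · have ht : t = 0 := by simpa [hv] using htv
    exact ⟨0, u / s, by simp, by field_simp, by simp [ht]⟩
  refine ⟨u * t / (v * s), u / s, ?_, by field_simp, by field_simp⟩
  rw [norm_div, norm_mul, norm_mul]
  refine div_le_one_of_le₀ ?_ (by positivity)
  rw [mul_comm]
  exact mul_le_mul htv h (norm_nonneg _) (norm_nonneg _)

/-- A pair of pure qubit states can be transformed into any pair that is at most as far apart. -/
theorem exists_isQuantumOperation_map_pureState {a₀ a₁ b₀ b₁ : EuclideanSpace ℂ (Fin 2)}
    (ha₀ : ‖a₀‖ = 1) (ha₁ : ‖a₁‖ = 1) (hb₀ : ‖b₀‖ = 1) (hb₁ : ‖b₁‖ = 1)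
    (h : ‖(inner ℂ a₀ a₁ : ℂ)‖ ≤ ‖(inner ℂ b₀ b₁ : ℂ)‖) :
    ∃ T : Op 2 →ₗ[ℂ] Op 2, IsQuantumOperation T ∧ T (pureState a₀) = pureState b₀ ∧
      T (pureState a₁) = pureState b₁ := by
  obtain ⟨a', -, haa, ha⟩ := exists_orthonormal_complement ha₀
  obtain ⟨b', hb', hbb, hb⟩ := exists_orthonormal_complement hb₀
  obtain ⟨y, l, hy, hu, hv⟩ := exists_norm_le_one_mul_eq
    ((norm_sq_inner_add_norm_sq_inner ha a₁).trans (by rw [ha₁, one_pow]))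
    ((norm_sq_inner_add_norm_sq_inner hb b₁).trans (by rw [hb₁, one_pow])) h
  have haa' : (inner ℂ a' a₀ : ℂ) = 0 := by rw [← inner_conj_symm, haa, map_zero]
  have hK := isKraus_pair ha hb₀ hb' hbb hb₁ (y := y) (r := √(1 - ‖y‖ ^ 2)) (by
    rw [Real.sq_sqrt (by nlinarith [norm_nonneg y])]
    ring)
  refine ⟨_, ⟨_, _, hK, rfl⟩, ?_, ?_⟩
  · rw [krausMap_pureState, Fin.sum_univ_two]
    simp only [Matrix.cons_val_zero, Matrix.cons_val_one, map_add, map_smul, LinearMap.add_apply,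
      LinearMap.smul_apply, toEuclideanLin_ketBra, haa', inner_self_eq_norm_sq_to_K, ha₀]
    ext i j
    simp [pureState]
  · have ht := trace_krausMap hK (pureState a₁)
    have e : (inner ℂ a₀ a₁ : ℂ) • b₀ + (y * (inner ℂ a' a₁ : ℂ)) • b' = l • b₁ := by
      conv_rhs => rw [eq_add_of_ketBra_add_eq_one hb b₁]
      rw [smul_add, smul_smul, smul_smul, ← hu, ← hv]
    rw [krausMap_pureState, Fin.sum_univ_two] at ht ⊢
    simp only [Matrix.cons_val_zero, Matrix.cons_val_one, map_add, map_smul, LinearMap.add_apply,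
      LinearMap.smul_apply, toEuclideanLin_ketBra, smul_smul, e, pureState_smul, ← add_smul] at ht ⊢
    rw [(isState_pureState ha₁).2, Matrix.trace_smul, (isState_pureState hb₁).2, smul_eq_mul,
      mul_one] at ht
    rw [ht, one_smul]

theorem seqOutput_congr {d : ℕ} {X : Op d →ₗ[ℂ] Op d} {T T' : ℕ → (Op d →ₗ[ℂ] Op d)} {ρ : Op d}
    {N : ℕ} (h : ∀ k < N, T k = T' k) : seqOutput X T ρ N = seqOutput X T' ρ N := by
  induction N with
  | zero => rfl
  | succ n ih =>
    rw [seqOutput, seqOutput, ih fun k hk => h k (hk.trans n.lt_succ_self), h n n.lt_succ_self]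

/-! ### Schemes that accumulate the angle. -/

/-- A pair of operators is reachable if a sequential scheme with `N` queries outputs the first
one when querying `X` and the second one when querying the identity. -/
def Reachable {d : ℕ} (X : Op d →ₗ[ℂ] Op d) (N : ℕ) (σ τ : Op d) : Prop :=
  ∃ (ρ : Op d) (T : ℕ → (Op d →ₗ[ℂ] Op d)), IsState ρ ∧ (∀ k, IsQuantumOperation (T k)) ∧
    seqOutput X T ρ N = σ ∧ seqOutput LinearMap.id T ρ N = τ

theorem Reachable.succ {d : ℕ} {X : Op d →ₗ[ℂ] Op d} {N : ℕ} {σ τ : Op d}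
    (h : Reachable X N σ τ) {T : Op d →ₗ[ℂ] Op d} (hT : IsQuantumOperation T) :
    Reachable X (N + 1) (T (X σ)) (T τ) := by
  obtain ⟨ρ, S, hρ, hS, rfl, rfl⟩ := h
  have hc : ∀ k < N, S k = Function.update S N T k := fun k hk => by
    rw [Function.update_of_ne hk.ne]
  refine ⟨ρ, Function.update S N T, hρ, fun k => ?_, ?_, ?_⟩
  · rcases eq_or_ne k N with rfl | hk
    · simpa using hT
    · simpa [Function.update_of_ne hk] using hS k
  · rw [seqOutput, Function.update_self, seqOutput_congr hc]
  · rw [seqOutput, Function.update_self, seqOutput_congr hc, LinearMap.id_apply]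

theorem pureState_eq_of_norm_inner_eq_one {d : ℕ} {x y : EuclideanSpace ℂ (Fin d)} (hx : ‖x‖ = 1)
    (hy : ‖y‖ = 1) (h : ‖(inner ℂ x y : ℂ)‖ = 1) : pureState x = pureState y := by
  obtain ⟨r, -, hr⟩ := (norm_inner_eq_norm_iff (𝕜 := ℂ) (norm_ne_zero_iff.1 (hx ▸ one_ne_zero))
    (norm_ne_zero_iff.1 (hy ▸ one_ne_zero))).1 (by rw [h, hx, hy, one_mul])
  have hr' : ‖r‖ = 1 := by
    rw [hr, norm_smul, hx, mul_one] at hy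
    exact hy
  rw [hr, pureState_smul, hr']
  simp

/-- Coplanar continuation: from `φ` past `ψ` by an angle `δ`. -/
theorem exists_unit_norm_inner_eq_cos_add {ψ φ : EuclideanSpace ℂ (Fin 2)} (hψ : ‖ψ‖ = 1)
    (hφ : ‖φ‖ = 1) (δ : ℝ) : ∃ χ : EuclideanSpace ℂ (Fin 2), ‖χ‖ = 1 ∧
      ‖(inner ℂ ψ χ : ℂ)‖ = |Real.cos δ| ∧
      ‖(inner ℂ φ χ : ℂ)‖ = |Real.cos (lineAngle φ ψ + δ)| := by
  obtain ⟨ψ', hψ', hψψ, hc⟩ := exists_orthonormal_complement hψ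
  have hψψ' : (inner ℂ ψ' ψ : ℂ) = 0 := by rw [← inner_conj_symm, hψψ, map_zero]
  obtain ⟨c, hc1, hc2⟩ := exists_phase (inner ℂ φ ψ)
  obtain ⟨e, he1, he2⟩ := exists_phase (inner ℂ φ ψ')
  have hsum := norm_sq_inner_add_norm_sq_inner hc φ
  rw [hφ, norm_inner_symm, norm_inner_symm ψ'] at hsum
  have hsin : Real.sin (lineAngle φ ψ) = ‖(inner ℂ φ ψ' : ℂ)‖ := by
    rw [lineAngle, Real.sin_arccos, ← Real.sqrt_sq (norm_nonneg (inner ℂ φ ψ' : ℂ))]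
    congr 1
    linarith
  have hcos : Real.cos (lineAngle φ ψ) = ‖(inner ℂ φ ψ : ℂ)‖ := by
    rw [lineAngle, Real.cos_arccos (by linarith [norm_nonneg (inner ℂ φ ψ : ℂ)])]
    nlinarith [norm_nonneg (inner ℂ φ ψ : ℂ), norm_nonneg (inner ℂ φ ψ' : ℂ)]
  have hi1 : (inner ℂ ψ (((Real.cos δ : ℝ) * c : ℂ) • ψ - ((Real.sin δ : ℝ) * e : ℂ) • ψ') : ℂ) =
      (Real.cos δ : ℝ) * c := by
    rw [inner_sub_right, inner_smul_right, inner_smul_right, hψψ, inner_self_eq_norm_sq_to_K, hψ]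
    simp
  have hi2 : (inner ℂ ψ' (((Real.cos δ : ℝ) * c : ℂ) • ψ - ((Real.sin δ : ℝ) * e : ℂ) • ψ') : ℂ) =
      -((Real.sin δ : ℝ) * e) := by
    rw [inner_sub_right, inner_smul_right, inner_smul_right, hψψ', inner_self_eq_norm_sq_to_K, hψ']
    simp
  -- The minus sign places χ on the far side of ψ from φ; the phases align both terms of ⟨φ, χ⟩,
  -- giving the addition formula for the cosine.
  refine ⟨((Real.cos δ : ℝ) * c : ℂ) • ψ - ((Real.sin δ : ℝ) * e : ℂ) • ψ', ?_, ?_, ?_⟩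
  · have h := norm_sq_inner_add_norm_sq_inner hc
      (((Real.cos δ : ℝ) * c : ℂ) • ψ - ((Real.sin δ : ℝ) * e : ℂ) • ψ')
    rw [hi1, hi2, norm_neg, norm_mul, norm_mul, hc1, he1, Complex.norm_real, Complex.norm_real,
      mul_one, mul_one, Real.norm_eq_abs, Real.norm_eq_abs, sq_abs, sq_abs,
      Real.cos_sq_add_sin_sq] at h
    exact (pow_eq_one_iff_of_nonneg (norm_nonneg _) two_ne_zero).1 h.symm
  · rw [hi1, norm_mul, hc1, Complex.norm_real, mul_one, Real.norm_eq_abs]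
  · rw [inner_sub_right, inner_smul_right, inner_smul_right, mul_assoc, hc2, mul_assoc, he2,
      Real.cos_add, hsin, hcos, ← Real.norm_eq_abs, ← Complex.norm_real]
    congr 1
    push_cast
    ring

/-- If some query output is a pure state at angle `θ` from the pure input, then `N` queries reach
all pairs of pure states at an angle of at most `N * θ`. -/
theorem reachable_pureState {X : Op 2 →ₗ[ℂ] Op 2} {ψ φ : EuclideanSpace ℂ (Fin 2)} (hψ : ‖ψ‖ = 1)
    (hφ : ‖φ‖ = 1) (hX : X (pureState ψ) = pureState φ) (N : ℕ) :
    ∀ {x y : EuclideanSpace ℂ (Fin 2)}, ‖x‖ = 1 → ‖y‖ = 1 → lineAngle x y ≤ N * lineAngle φ ψ →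
      Reachable X N (pureState x) (pureState y) := by
  induction N with
  | zero =>
    intro x y hx hy h
    have h1 : ‖(inner ℂ x y : ℂ)‖ = 1 := by
      refine le_antisymm ?_ ?_
      · simpa [hx, hy] using norm_inner_le_norm (𝕜 := ℂ) x y
      · rw [← Real.arccos_eq_zero]
        exact le_antisymm (by simpa [lineAngle] using h) (Real.arccos_nonneg _)
    exact ⟨pureState x, fun _ => LinearMap.id, isState_pureState hx, fun _ => isQuantumOperation_id,
      rfl, pureState_eq_of_norm_inner_eq_one hx hy h1⟩
  | succ n ih =>
    intro x y hx hy h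
    set θ := lineAngle φ ψ
    have hθ : 0 ≤ θ := lineAngle_nonneg _ _
    have hγ := lineAngle_le_pi_div_two x y
    have hγ0 := lineAngle_nonneg x y
    have hθ2 : θ ≤ Real.pi / 2 := lineAngle_le_pi_div_two _ _
    -- The angle left to the first n queries, truncated at 0 when one query suffices. Since θ + δ ≤
    -- π/2, the cosines below are nonnegative.
    set δ := max (lineAngle x y - θ) 0
    have hδ0 : 0 ≤ δ := le_max_right _ _
    have hδ1 : δ ≤ Real.pi / 2 - θ := max_le (by linarith) (by linarith)
    have hδ2 : δ ≤ n * θ := max_le (by push_cast at h; linarith) (by positivity)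
    have hδ3 : lineAngle x y ≤ θ + δ := by linarith [le_max_left (lineAngle x y - θ) 0]
    obtain ⟨χ, hχ, h1, h2⟩ := exists_unit_norm_inner_eq_cos_add hψ hφ δ
    have hr := ih hψ hχ (by
      rw [lineAngle, h1, abs_of_nonneg (Real.cos_nonneg_of_neg_pi_div_two_le_of_le
        (by linarith [Real.pi_pos]) (by linarith)), Real.arccos_cos hδ0 (by linarith [Real.pi_pos])]
      exact hδ2)
    -- After the query the branches hold φ and χ, at angle θ + δ, which covers the target angle.
    obtain ⟨T, hT, hTx, hTy⟩ := exists_isQuantumOperation_map_pureState hφ hχ hx hy (by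
      rw [h2, abs_of_nonneg (Real.cos_nonneg_of_neg_pi_div_two_le_of_le
        (by linarith [Real.pi_pos]) (by linarith))]
      have hle : ‖(inner ℂ x y : ℂ)‖ ≤ 1 := by
        simpa [hx, hy] using norm_inner_le_norm (𝕜 := ℂ) x y
      rw [← Real.cos_arccos (by linarith [norm_nonneg (inner ℂ x y : ℂ)]) hle]
      exact Real.cos_le_cos_of_nonneg_of_le_pi hγ0 (by linarith [Real.pi_pos]) hδ3)
    have := hr.succ hT
    rwa [hX, hTx, hTy] at this

theorem seqDistinguishableIn_of_pi_div_two_le {X : Op 2 →ₗ[ℂ] Op 2}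
    {ψ φ : EuclideanSpace ℂ (Fin 2)} (hψ : ‖ψ‖ = 1) (hφ : ‖φ‖ = 1)
    (hX : X (pureState ψ) = pureState φ) {N : ℕ} (h : Real.pi / 2 ≤ N * lineAngle φ ψ) :
    SeqDistinguishableIn X LinearMap.id N := by
  obtain ⟨ψ', hψ', h0, hc⟩ := exists_orthonormal_complement hψ
  obtain ⟨ρ, T, hρ, hT, h1, h2⟩ := reachable_pureState hψ hφ hX N hψ hψ'
    ((lineAngle_le_pi_div_two _ _).trans h)
  refine ⟨ρ, T, hρ, hT, pureState ψ, (isState_pureState hψ).1, ?_, ?_, ?_⟩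
  · rw [← hc, pureState_eq_ketBra, add_sub_cancel_left]
    exact (isState_pureState hψ').1
  · rw [h1, pureState_eq_ketBra, ketBra_mul_ketBra, Matrix.trace_smul, trace_ketBra,
      inner_self_eq_norm_sq_to_K, hψ]
    simp
  · rw [h2, pureState_eq_ketBra, pureState_eq_ketBra, ketBra_mul_ketBra, h0, zero_smul,
      Matrix.trace_zero]

/-! ### Minimal fidelity of a qubit operation. -/

theorem mul_ketBra {d d' d'' : ℕ} (A : Matrix (Fin d'') (Fin d') ℂ)
    (x : EuclideanSpace ℂ (Fin d')) (y : EuclideanSpace ℂ (Fin d)) :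
    A * ketBra x y = ketBra (Matrix.toEuclideanLin A x) y := by
  ext i j
  simp [ketBra, Matrix.toLpLin_apply, Matrix.mulVec, dotProduct, Matrix.mul_apply, Finset.sum_mul,
    mul_assoc]

/-- The orthogonal complement of a kernel vector is an eigenline, whose eigenvalue is the trace. -/
theorem exists_eq_pureState_of_det_eq_zero {ρ : Op 2} (h : IsState ρ) (hd : ρ.det = 0) :
    ∃ φ : EuclideanSpace ℂ (Fin 2), ‖φ‖ = 1 ∧ ρ = pureState φ := by
  obtain ⟨w, hw, hw0⟩ := Matrix.exists_mulVec_eq_zero_iff.2 hd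
  have hx0 : WithLp.toLp 2 w ≠ (0 : EuclideanSpace ℂ (Fin 2)) := by simpa using hw
  set v := ((‖(WithLp.toLp 2 w : EuclideanSpace ℂ (Fin 2))‖ : ℂ)⁻¹) •
    (WithLp.toLp 2 w : EuclideanSpace ℂ (Fin 2))
  have hv : ‖v‖ = 1 := norm_inv_norm_smul hx0
  have hρv : Matrix.toEuclideanLin ρ v = 0 := by
    rw [map_smul, Matrix.toLpLin_apply, hw0]
    simp
  obtain ⟨φ, hφ, -, hc⟩ := exists_orthonormal_complement hv
  have h1 : Matrix.toEuclideanLin ρ φ = (inner ℂ φ (Matrix.toEuclideanLin ρ φ) : ℂ) • φ := by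
    have := eq_add_of_ketBra_add_eq_one hc (Matrix.toEuclideanLin ρ φ)
    have h0 : (inner ℂ v (Matrix.toEuclideanLin ρ φ) : ℂ) = 0 := by
      have h2 := inner_toEuclideanLin_left ρ v φ
      rw [h.1.1.eq, hρv, inner_zero_left] at h2
      exact h2.symm
    rwa [h0, zero_smul, zero_add] at this
  have h2 : ρ = (inner ℂ φ (Matrix.toEuclideanLin ρ φ) : ℂ) • pureState φ := by
    conv_lhs => rw [← mul_one ρ, ← hc, mul_add, mul_ketBra, mul_ketBra, hρv, h1, ketBra_smul_left]
    rw [pureState_eq_ketBra, add_eq_right]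
    ext i j
    simp [ketBra]
  have h3 := congrArg Matrix.trace h2
  rw [h.2, Matrix.trace_smul, (isState_pureState hφ).2, smul_eq_mul, mul_one] at h3
  exact ⟨φ, hφ, by rw [← h3, one_smul] at h2; exact h2⟩

theorem supp_eq_top_of_det_ne_zero {d : ℕ} {ρ : Op d} (h : ρ.PosSemidef) (hd : ρ.det ≠ 0) :
    supp ρ = ⊤ := by
  rw [supp_eq_orthogonal_ker h, Submodule.orthogonal_eq_top_iff, LinearMap.ker_eq_bot']
  intro v hv
  by_contra hv0
  refine hd (Matrix.exists_mulVec_eq_zero_iff.1 ⟨v.ofLp, by simpa using hv0, ?_⟩)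
  simpa [Matrix.toLpLin_apply] using hv

theorem norm_inner_le_maxFidelity {d : ℕ} {ρ σ : Op d} {x y : EuclideanSpace ℂ (Fin d)}
    (hx : x ∈ supp ρ) (hy : y ∈ supp σ) (hxn : ‖x‖ = 1) (hyn : ‖y‖ = 1) :
    ‖(inner ℂ x y : ℂ)‖ ≤ maxFidelity ρ σ := by
  refine le_csSup ⟨1, ?_⟩ ⟨x, hx, y, hy, hxn, hyn, rfl⟩
  rintro _ ⟨u, -, v, -, hu, hv, rfl⟩
  simpa [hu, hv] using norm_inner_le_norm (𝕜 := ℂ) u v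

theorem maxFidelity_nonneg {d : ℕ} (ρ σ : Op d) : 0 ≤ maxFidelity ρ σ := by
  refine Real.sSup_nonneg ?_
  rintro _ ⟨u, -, v, -, -, -, rfl⟩
  exact norm_nonneg _

theorem self_mem_supp_pureState {d : ℕ} {ψ : EuclideanSpace ℂ (Fin d)} (h : ‖ψ‖ = 1) :
    ψ ∈ supp (pureState ψ) :=
  (mem_supp_pureState h).2 ⟨1, (one_smul _ _).symm⟩

theorem maxFidelity_pureState {d : ℕ} {φ ψ : EuclideanSpace ℂ (Fin d)} (hφ : ‖φ‖ = 1)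
    (hψ : ‖ψ‖ = 1) : maxFidelity (pureState φ) (pureState ψ) = ‖(inner ℂ φ ψ : ℂ)‖ := by
  refine le_antisymm (Real.sSup_le ?_ (norm_nonneg _)) (norm_inner_le_maxFidelity
    (self_mem_supp_pureState hφ) (self_mem_supp_pureState hψ) hφ hψ)
  rintro _ ⟨u, hu, v, hv, hun, hvn, rfl⟩
  obtain ⟨c, rfl⟩ := (mem_supp_pureState hφ).1 hu
  obtain ⟨e, rfl⟩ := (mem_supp_pureState hψ).1 hv
  rw [norm_smul, hφ, mul_one] at hun
  rw [norm_smul, hψ, mul_one] at hvn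
  rw [inner_smul_left, inner_smul_right, norm_mul, norm_mul, RCLike.norm_conj, hun, hvn]
  simp

theorem one_le_maxFidelity_of_det_ne_zero {d : ℕ} {ρ : Op d} (h : ρ.PosSemidef) (hd : ρ.det ≠ 0)
    {ψ : EuclideanSpace ℂ (Fin d)} (hψ : ‖ψ‖ = 1) : 1 ≤ maxFidelity ρ (pureState ψ) := by
  have := norm_inner_le_maxFidelity (ρ := ρ) (σ := pureState ψ) (x := ψ) (y := ψ)
    (by rw [supp_eq_top_of_det_ne_zero h hd]; trivial) (self_mem_supp_pureState hψ) hψ hψ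
  simpa [inner_self_eq_norm_sq_to_K, hψ] using this

theorem qMaxFidelity_one_le {d d' : ℕ} (X₀ X₁ : Op d →ₗ[ℂ] Op d') {ψ : EuclideanSpace ℂ (Fin d)}
    (hψ : ‖ψ‖ = 1) :
    qMaxFidelity 1 X₀ X₁ ≤ maxFidelity (X₀ (pureState ψ)) (X₁ (pureState ψ)) := by
  refine csInf_le ⟨0, ?_⟩ ⟨ψ, ψ, hψ, hψ, by simp [inner_self_eq_norm_sq_to_K, hψ], rfl⟩
  rintro _ ⟨_, _, -, -, -, rfl⟩
  exact maxFidelity_nonneg _ _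

theorem exists_maxFidelity_of_mem_qMaxFidelity_one {d d' : ℕ} {X₀ X₁ : Op d →ₗ[ℂ] Op d'} {x : ℝ}
    (hx : ∃ ψ₀ ψ₁ : EuclideanSpace ℂ (Fin d), ‖ψ₀‖ = 1 ∧ ‖ψ₁‖ = 1 ∧ inner ℂ ψ₀ ψ₁ = ((1 : ℝ) : ℂ) ∧
      x = maxFidelity (X₀ (pureState ψ₀)) (X₁ (pureState ψ₁))) :
    ∃ ψ : EuclideanSpace ℂ (Fin d), ‖ψ‖ = 1 ∧
      x = maxFidelity (X₀ (pureState ψ)) (X₁ (pureState ψ)) := by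
  obtain ⟨ψ₀, ψ₁, h0, h1, h, rfl⟩ := hx
  obtain rfl := (inner_eq_one_iff_of_norm_eq_one (𝕜 := ℂ) h0 h1).1 (by simpa using h)
  exact ⟨ψ₀, h0, rfl⟩

theorem exists_lineAngle_le_arccos_qMaxFidelity {X : Op 2 →ₗ[ℂ] Op 2} (hX : IsQuantumOperation X)
    {ψ : EuclideanSpace ℂ (Fin 2)} (hψ : ‖ψ‖ = 1) :
    ∃ φ ∈ supp (X (pureState ψ)), ‖φ‖ = 1 ∧
      lineAngle φ ψ ≤ Real.arccos (qMaxFidelity 1 X LinearMap.id) := by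
  have hs := isState_apply hX (isState_pureState hψ)
  by_cases hd : (X (pureState ψ)).det = 0
  · obtain ⟨φ, hφ, h⟩ := exists_eq_pureState_of_det_eq_zero hs hd
    refine ⟨φ, h ▸ self_mem_supp_pureState hφ, hφ, Real.arccos_le_arccos ?_⟩
    rw [← maxFidelity_pureState hφ hψ, ← h]
    exact qMaxFidelity_one_le X LinearMap.id hψ
  · refine ⟨ψ, by rw [supp_eq_top_of_det_ne_zero hs.1 hd]; trivial, hψ, ?_⟩
    simpa [lineAngle, inner_self_eq_norm_sq_to_K, hψ] using Real.arccos_nonneg _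

theorem continuous_pureState {d : ℕ} :
    Continuous (pureState : EuclideanSpace ℂ (Fin d) → Op d) := by
  refine continuous_matrix fun i j => ?_
  simp only [pureState, Matrix.of_apply]
  fun_prop

theorem trace_pureState_mul_pureState {d : ℕ} (ψ φ : EuclideanSpace ℂ (Fin d)) :
    (pureState ψ * pureState φ).trace = ((‖(inner ℂ φ ψ : ℂ)‖ ^ 2 : ℝ) : ℂ) := by
  rw [pureState_eq_ketBra, pureState_eq_ketBra, ketBra_mul_ketBra, Matrix.trace_smul, trace_ketBra,
    smul_eq_mul, ← inner_conj_symm ψ φ]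
  push_cast
  exact Complex.conj_mul' _

/-- If the minimal fidelity of input and output is below one, it is attained at a pure input with
pure output. -/
theorem exists_pureState_norm_inner_le_qMaxFidelity {X : Op 2 →ₗ[ℂ] Op 2}
    (hX : IsQuantumOperation X) (h : qMaxFidelity 1 X LinearMap.id < 1) :
    ∃ ψ φ : EuclideanSpace ℂ (Fin 2), ‖ψ‖ = 1 ∧ ‖φ‖ = 1 ∧ X (pureState ψ) = pureState φ ∧
      ‖(inner ℂ φ ψ : ℂ)‖ ≤ qMaxFidelity 1 X LinearMap.id := by
  have hXc : Continuous fun ψ : EuclideanSpace ℂ (Fin 2) => X (pureState ψ) :=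
    X.continuous_of_finiteDimensional.comp continuous_pureState
  set V := Metric.sphere (0 : EuclideanSpace ℂ (Fin 2)) 1 ∩ {ψ | (X (pureState ψ)).det = 0}
  have hV : IsCompact V := (isCompact_sphere _ _).inter_right
    (isClosed_eq hXc.matrix_det continuous_const)
  set e : EuclideanSpace ℂ (Fin 2) := EuclideanSpace.single 0 1
  have he : ‖e‖ = 1 := by simp [e]
  have hne : {x | ∃ ψ₀ ψ₁ : EuclideanSpace ℂ (Fin 2), ‖ψ₀‖ = 1 ∧ ‖ψ₁‖ = 1 ∧
      inner ℂ ψ₀ ψ₁ = ((1 : ℝ) : ℂ) ∧ x = maxFidelity (X (pureState ψ₀))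
        ((LinearMap.id : Op 2 →ₗ[ℂ] Op 2) (pureState ψ₁))}.Nonempty :=
    ⟨_, e, e, he, he, by simp [inner_self_eq_norm_sq_to_K, he], rfl⟩
  obtain ⟨x, hx, hx1⟩ := exists_lt_of_csInf_lt hne h
  obtain ⟨ψ₁, hψ₁, rfl⟩ := exists_maxFidelity_of_mem_qMaxFidelity_one hx
  have hVne : V.Nonempty := by
    refine ⟨ψ₁, by simpa using hψ₁, ?_⟩
    by_contra hd
    exact (one_le_maxFidelity_of_det_ne_zero (isState_apply hX (isState_pureState hψ₁)).1 hd
      hψ₁).not_gt hx1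
  -- On V, where outputs are pure, this trace is the squared fidelity. It is continuous in ψ and so
  -- attains its minimum on the compact set V; off V the fidelity is at least 1.
  obtain ⟨ψ, hψ, hmin⟩ := hV.exists_isMinOn hVne
    (f := fun ψ => ((pureState ψ * X (pureState ψ)).trace).re)
    (Complex.continuous_re.comp (continuous_pureState.matrix_mul hXc).matrix_trace).continuousOn
  have hψn : ‖ψ‖ = 1 := by simpa using hψ.1
  obtain ⟨φ, hφ, hφX⟩ := exists_eq_pureState_of_det_eq_zero
    (isState_apply hX (isState_pureState hψn)) hψ.2
  refine ⟨ψ, φ, hψn, hφ, hφX, le_csInf hne fun y hy => ?_⟩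
  obtain ⟨ψ', hψ', rfl⟩ := exists_maxFidelity_of_mem_qMaxFidelity_one hy
  have hs' := isState_apply hX (isState_pureState hψ')
  by_cases hd : (X (pureState ψ')).det = 0
  · obtain ⟨φ', hφ', hφX'⟩ := exists_eq_pureState_of_det_eq_zero hs' hd
    have hle := isMinOn_iff.1 hmin ψ' ⟨by simpa using hψ', hd⟩
    simp only [hφX, hφX', trace_pureState_mul_pureState, Complex.ofReal_re] at hle
    rw [hφX', LinearMap.id_apply, maxFidelity_pureState hφ' hψ']
    exact (sq_le_sq₀ (norm_nonneg _) (norm_nonneg _)).1 hle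
  · refine le_trans ?_ (one_le_maxFidelity_of_det_ne_zero hs'.1 hd hψ')
    simpa [hφ, hψn] using norm_inner_le_norm (𝕜 := ℂ) φ ψ

end QuantumDiscrimination

/-! ### The theorem. -/

theorem theorem1 (m : ℕ) (hm₂ : 2 ≤ m) (hm₃ : m ≤ 3)
    (E : Fin m → Matrix (Fin 2) (Fin 2) ℂ) (hE : IsKraus E) :
    (SeqDistinguishable (krausMap E) LinearMap.id ↔
      qMaxFidelity 1 (krausMap E) LinearMap.id < 1) ∧
    (qMaxFidelity 1 (krausMap E) LinearMap.id < 1 →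
      IsLeast {N : ℕ | SeqDistinguishableIn (krausMap E) LinearMap.id N}
        ⌈Real.pi / (2 * Real.arccos (qMaxFidelity 1 (krausMap E) LinearMap.id))⌉₊) := by
  have hX : IsQuantumOperation (krausMap E) := ⟨m, E, hE, rfl⟩
  have lower : ∀ {N : ℕ}, SeqDistinguishableIn (krausMap E) LinearMap.id N →
      Real.pi / 2 ≤ N * Real.arccos (qMaxFidelity 1 (krausMap E) LinearMap.id) := fun h =>
    pi_div_two_le_of_seqDistinguishableIn hX
      (fun ψ hψ => exists_lineAngle_le_arccos_qMaxFidelity hX hψ) h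
  have least : qMaxFidelity 1 (krausMap E) LinearMap.id < 1 →
      IsLeast {N : ℕ | SeqDistinguishableIn (krausMap E) LinearMap.id N}
        ⌈Real.pi / (2 * Real.arccos (qMaxFidelity 1 (krausMap E) LinearMap.id))⌉₊ := by
    intro hF
    have hθ : 0 < Real.arccos (qMaxFidelity 1 (krausMap E) LinearMap.id) := Real.arccos_pos.2 hF
    constructor
    · obtain ⟨ψ, φ, hψ, hφ, hφX, hle⟩ := exists_pureState_norm_inner_le_qMaxFidelity hX hF
      refine seqDistinguishableIn_of_pi_div_two_le hψ hφ hφX ?_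
      have h1 := Nat.le_ceil
        (Real.pi / (2 * Real.arccos (qMaxFidelity 1 (krausMap E) LinearMap.id)))
      rw [← div_div, div_le_iff₀ hθ] at h1
      rw [← div_div]
      exact h1.trans (mul_le_mul_of_nonneg_left (Real.arccos_le_arccos hle) (Nat.cast_nonneg _))
    · intro N hN
      rw [Nat.ceil_le, ← div_div, div_le_iff₀ hθ]
      exact lower hN
  refine ⟨⟨fun ⟨N, hN⟩ => ?_, fun hF => ⟨_, (least hF).1⟩⟩, least⟩
  by_contra hF
  have h := lower hN
  -- If the fidelity is at least 1, then θ = 0 and the lower bound would read π/2 ≤ 0.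
  rw [Real.arccos_of_one_le (not_lt.1 hF), mul_zero] at h
  linarith [Real.pi_pos]
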